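/- **Definitions.** A group is *torsion-free* if its only element of finite order is the identity. A subgroup $L$ of a group $G$ is *$q$-normal*, written $L\leq_q G$, if there is a generating set $S$ of $G$ such that $sLs^{-1}\cap L$ is infinite for every $s\in S$. A *mean* on a set $X$ is a finitely additive probability measure $\mu:\mathcal P(X)\to[0,1]$ defined on all subsets of $X$. A group $G$ is *amenable* if there is a mean $\mu$ on $G$ with $\mu(gA)=\mu(A)$ for all $g\in G$ and $A\subseteq G$. It is *inner-amenable* if there is a mean $\mu$ on $G$ with $\mu(gAg^{-1})=\mu(A)$ for all $g\in G$ and $A\subseteq G$, and $\mu(\{x\})=0$ for all $x\in G$. **Theorem 3.5.** Let $\mathcal C$ be a class of finitely generated, torsion-free groups that contains $\mathbb Z$ and is closed under taking finitely generated subgroups. Let $P$ be a property of groups in $\mathcal C$ that is invariant under isomorphism. Suppose that 1. $\mathbb Z$ satisfies $P$; 2. for every $G\in\mathcal C$ and every subgroup $L\leq_q G$ with $L\in\mathcal C$, if $L$ satisfies $P$, then so does $G$. Then every group in $\mathcal C$ that is inner-amenable and not amenable satisfies $P$. -/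

import Mathlib

universe u

/-- `μ` is a finitely additive probability measure defined on all subsets of `X`
(monotonicity gives `μ A ≤ 1`, so that `μ` takes values in `[0, 1]`). -/
structure IsMean {X : Type*} (μ : Set X → ℝ) : Prop where
  nonneg : ∀ A : Set X, 0 ≤ μ A
  univ : μ Set.univ = 1
  union : ∀ A B : Set X, Disjoint A B → μ (A ∪ B) = μ A + μ B

/-- A (discrete) group is amenable if its action on itself by left translations admits an
invariant mean. -/
def IsAmenableGroup (G : Type*) [Group G] : Prop :=
  ∃ μ : Set G → ℝ, IsMean μ ∧ ∀ (g : G) (A : Set G), μ ((fun x => g * x) '' A) = μ A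

/-- A group is inner-amenable if its action on itself by conjugation admits an atomless
invariant mean. -/
def IsInnerAmenableGroup (G : Type*) [Group G] : Prop :=
  ∃ μ : Set G → ℝ, IsMean μ ∧
    (∀ (g : G) (A : Set G), μ ((fun x => g * x * g⁻¹) '' A) = μ A) ∧
    ∀ x : G, μ {x} = 0

/-- A group is torsion-free if no element other than `1` has finite order. (For non-commutative
groups this is weaker than Mathlib's `IsMulTorsionFree`, which asks for unique roots.) -/
def IsTorsionFreeGroup (G : Type*) [Group G] : Prop :=
  ∀ g : G, IsOfFinOrder g → g = 1

/-- `H` is q-normal in `G`: some generating set `S` of the group `G` is such that `sHs⁻¹ ∩ H` is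
infinite for every `s ∈ S`. -/
def IsQNormal {G : Type*} [Group G] (H : Subgroup G) : Prop :=
  ∃ S : Set G, Subgroup.closure S = ⊤ ∧
    ∀ s ∈ S, (((fun x => s * x * s⁻¹) '' (H : Set G)) ∩ (H : Set G)).Infinite

/-! The property `P` climbs a chain ⟨x⟩ ≤ K ≤ L ≤ G of q-normal inclusions. If a non-amenable group
acts with an invariant mean, almost every stabilizer is non-amenable: otherwise, integrating means
carried by amenable stabilizers would give an invariant mean on the group
(`mean_amenable_stabilizer_eq_zero`). Applied to conjugation by a non-amenable subgroup K, this says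
that almost every y commutes with a non-amenable subgroup of K, so K ∩ yKy⁻¹ is infinite by
torsion-freeness. Thus some x ≠ 1 has non-amenable centralizer. Take K finitely generated and
non-amenable in that centralizer, with x ∈ K; then ⟨x⟩ is central in K. For a finite generating set
S of G, a generic y ≠ 1 has y and all s⁻¹ys generic for K. Let L be generated by K and these
elements: K is q-normal in L, and L is q-normal in G because ⟨y⟩ ≤ L ∩ sLs⁻¹. -/

open Filter Topology

/-! ### Finitely additive means and their limits -/

namespace IsMean

variable {X : Type*} {m : Set X → ℝ}

theorem empty (hm : IsMean m) : m ∅ = 0 := by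
  have h := hm.union ∅ ∅ (by simp)
  simp only [Set.union_self] at h
  linarith

theorem mono (hm : IsMean m) {A B : Set X} (h : A ⊆ B) : m A ≤ m B := by
  have h1 := hm.union A (B \ A) Set.disjoint_sdiff_right
  rw [Set.union_sdiff_cancel h] at h1
  linarith [hm.nonneg (B \ A)]

theorem le_one (hm : IsMean m) (A : Set X) : m A ≤ 1 :=
  hm.univ ▸ hm.mono (Set.subset_univ A)

theorem biUnion_finset (hm : IsMean m) {ι : Type*} (s : Finset ι) (f : ι → Set X)
    (hf : Pairwise fun i j => Disjoint (f i) (f j)) :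
    m (⋃ i ∈ s, f i) = ∑ i ∈ s, m (f i) := by
  classical
  induction s using Finset.induction_on with
  | empty => simpa using hm.empty
  | insert a s ha ih =>
    rw [Finset.set_biUnion_insert, hm.union, ih, Finset.sum_insert ha]
    refine Set.disjoint_iUnion₂_right.2 fun i hi => hf ?_
    rintro rfl
    exact ha hi

theorem union_null (hm : IsMean m) {A B : Set X} (hA : m A = 0) (hB : m B = 0) :
    m (A ∪ B) = 0 := by
  have h := hm.union A (B \ A) Set.disjoint_sdiff_right
  rw [Set.union_sdiff_self] at h
  linarith [hm.nonneg (A ∪ B), hm.mono (Set.sdiff_subset : B \ A ⊆ B)]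

theorem biUnion_finset_null (hm : IsMean m) {ι : Type*} (s : Finset ι) (f : ι → Set X)
    (hf : ∀ i ∈ s, m (f i) = 0) : m (⋃ i ∈ s, f i) = 0 := by
  classical
  induction s using Finset.induction_on with
  | empty => simpa using hm.empty
  | insert a s ha ih =>
    rw [Finset.set_biUnion_insert]
    exact hm.union_null (hf a (by simp)) (ih fun i hi => hf i (by simp [hi]))

/-- Change of variables for the push-forward of a mean to a finite set. -/
theorem sum_comp (hm : IsMean m) {ι κ : Type*} [Fintype ι] [Fintype κ] (w : X → ι) (h : ι → κ)
    (φ : κ → ℝ) :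
    ∑ j, φ j * m {x | h (w x) = j} = ∑ i, φ (h i) * m {x | w x = i} := by
  classical
  have key : ∀ j, m {x | h (w x) = j} = ∑ i, if h i = j then m {x | w x = i} else 0 := by
    intro j
    rw [← Finset.sum_filter, ← hm.biUnion_finset]
    · congr 1
      ext x
      simp
    · intro a b hab
      refine Set.disjoint_left.2 fun x hx hx' => hab ?_
      exact hx.symm.trans hx'
  simp only [key, Finset.mul_sum]
  rw [Finset.sum_comm]
  refine Finset.sum_congr rfl fun i _ => ?_
  simp

theorem sum_fiber (hm : IsMean m) {ι : Type*} [Fintype ι] (w : X → ι) :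
    ∑ i, m {x | w x = i} = 1 := by
  have h := hm.sum_comp w (fun _ => ()) (fun _ => 1)
  simpa [hm.univ] using h.symm

/-- The image of a mean under a map is a mean. -/
theorem map {Y : Type*} (hm : IsMean m) (f : X → Y) : IsMean fun B => m (f ⁻¹' B) where
  nonneg _ := hm.nonneg _
  univ := hm.univ
  union _ _ h := hm.union _ _ (h.preimage f)

theorem subtype (hm : IsMean m) {A : Set X} (hA : m A ≠ 0) :
    IsMean fun B : Set A => m (Subtype.val '' B) / m A where
  nonneg _ := div_nonneg (hm.nonneg _) (hm.nonneg _)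
  univ := by simp [hA]
  union B B' h := by
    rw [Set.image_union, hm.union _ _ ((Set.disjoint_image_iff Subtype.val_injective).2 h), add_div]

end IsMean

/-- Uniformly bounded set functions have a pointwise limit along some ultrafilter. -/
theorem exists_ultrafilter_tendsto {ι α : Type*} (l : Filter ι) [l.NeBot] (ν : ι → α → ℝ)
    (h0 : ∀ i a, 0 ≤ ν i a) (h1 : ∀ i a, ν i a ≤ 1) :
    ∃ (U : Ultrafilter ι) (μ : α → ℝ), (U : Filter ι) ≤ l ∧
      ∀ a, Tendsto (fun i => ν i a) U (𝓝 (μ a)) := by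
  have hc : ∀ a, ∃ r, Tendsto (fun i => ν i a) (Ultrafilter.of l) (𝓝 r) := by
    intro a
    obtain ⟨r, -, hr⟩ := (isCompact_Icc (a := (0 : ℝ)) (b := 1)).ultrafilter_le_nhds
      ((Ultrafilter.of l).map fun i => ν i a)
      (le_principal_iff.2 (Filter.mem_map.2 (Eventually.of_forall fun i => ⟨h0 i a, h1 i a⟩)))
    exact ⟨r, hr⟩
  choose μ hμ using hc
  exact ⟨Ultrafilter.of l, μ, Ultrafilter.of_le l, hμ⟩

/-! ### Approximate integration against a mean -/

section Integral

variable {X : Type*}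

/-- The value of `N * f x` rounded down (and capped at `N`). -/
noncomputable def floorLevel (N : ℕ) (f : X → ℝ) (x : X) : Fin (N + 1) :=
  ⟨min ⌊N * f x⌋₊ N, by omega⟩

/-- The integral against `m` of the function `f` rounded down to a multiple of `1 / N`. -/
noncomputable def floorIntegral (m : Set X → ℝ) (N : ℕ) (f : X → ℝ) : ℝ :=
  ∑ k : Fin (N + 1), (k : ℝ) / N * m {x | floorLevel N f x = k}

variable {m : Set X → ℝ}

theorem floorIntegral_nonneg (hm : IsMean m) (N : ℕ) (f : X → ℝ) : 0 ≤ floorIntegral m N f :=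
  Finset.sum_nonneg fun _ _ => mul_nonneg (by positivity) (hm.nonneg _)

theorem floorIntegral_le_one (hm : IsMean m) (N : ℕ) (f : X → ℝ) : floorIntegral m N f ≤ 1 := by
  rw [← hm.sum_fiber (floorLevel N f)]
  refine Finset.sum_le_sum fun k _ => mul_le_of_le_one_left (hm.nonneg _) ?_
  exact div_le_one_of_le₀ (by exact_mod_cast Nat.lt_succ_iff.1 k.2) (by positivity)

theorem floorIntegral_one (hm : IsMean m) {N : ℕ} (hN : N ≠ 0) :
    floorIntegral m N (fun _ => 1) = 1 := by
  have h := hm.sum_comp (fun _ => ()) (fun _ => Fin.last N) fun k : Fin (N + 1) => (k : ℝ) / N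
  have hl : ∀ x : X, floorLevel N (fun _ => 1) x = Fin.last N := by
    intro x
    ext
    simp [floorLevel]
  have hN' : (N : ℝ) ≠ 0 := by exact_mod_cast hN
  simpa [floorIntegral, hl, hm.univ, hN'] using h

theorem floorLevel_le {N : ℕ} {f : X → ℝ} {x : X} (h0 : 0 ≤ f x) :
    ((floorLevel N f x : ℕ) : ℝ) ≤ N * f x :=
  (Nat.cast_le.2 (min_le_left _ _)).trans (Nat.floor_le (by positivity))

theorem lt_floorLevel_add_one {N : ℕ} {f : X → ℝ} {x : X} (h1 : f x ≤ 1) :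
    N * f x < ((floorLevel N f x : ℕ) : ℝ) + 1 := by
  have h2 : (N : ℝ) * f x ≤ N := mul_le_of_le_one_right (by positivity) h1
  have h : ⌊N * f x⌋₊ ≤ N := Nat.floor_le_of_le h2
  simpa [floorLevel, min_eq_left h] using Nat.lt_floor_add_one ((N : ℝ) * f x)

/-- On each joint level set of `f`, `g`, `h`, with levels a, b, c, rounding gives -1 < c - a - b <
2. -/
theorem abs_floorIntegral_add_sub_le (hm : IsMean m) (N : ℕ) {f g h : X → ℝ}
    (hf0 : ∀ x, 0 ≤ f x) (hg0 : ∀ x, 0 ≤ g x) (hh1 : ∀ x, h x ≤ 1) (hfg : ∀ x, h x = f x + g x) :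
    |floorIntegral m N h - (floorIntegral m N f + floorIntegral m N g)| ≤ 2 / N := by
  let w : X → Fin (N + 1) × Fin (N + 1) × Fin (N + 1) := fun x =>
    (floorLevel N f x, floorLevel N g x, floorLevel N h x)
  have ef := hm.sum_comp w (fun i => i.1) fun k => (k : ℝ) / N
  have eg := hm.sum_comp w (fun i => i.2.1) fun k => (k : ℝ) / N
  have eh := hm.sum_comp w (fun i => i.2.2) fun k => (k : ℝ) / N
  simp only [floorIntegral]
  simp only [w] at ef eg eh
  rw [ef, eg, eh, ← Finset.sum_add_distrib, ← Finset.sum_sub_distrib]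
  refine (Finset.abs_sum_le_sum_abs _ _).trans ?_
  rw [← mul_one (2 / (N : ℝ)), ← hm.sum_fiber w, Finset.mul_sum]
  refine Finset.sum_le_sum fun i _ => ?_
  rw [← add_mul, ← sub_mul, abs_mul, abs_of_nonneg (hm.nonneg _)]
  rcases Set.eq_empty_or_nonempty {x | w x = i} with he | ⟨x, rfl⟩
  · simp only [w] at he
    simp [w, he, hm.empty]
  · refine mul_le_mul_of_nonneg_right ?_ (hm.nonneg _)
    rw [← add_div, ← sub_div, abs_div, Nat.abs_cast]
    refine div_le_div_of_nonneg_right ?_ (by positivity)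
    have hx := hfg x
    have hm : (N : ℝ) * h x = N * f x + N * g x := by rw [hx]; ring
    have a1 := floorLevel_le (N := N) (hf0 x)
    have a2 := floorLevel_le (N := N) (hg0 x)
    have a3 := floorLevel_le (N := N) (f := h) (x := x) (by linarith [hf0 x, hg0 x])
    have b1 := lt_floorLevel_add_one (N := N) (f := f) (x := x) (by linarith [hg0 x, hh1 x])
    have b2 := lt_floorLevel_add_one (N := N) (f := g) (x := x) (by linarith [hf0 x, hh1 x])
    have b3 := lt_floorLevel_add_one (N := N) (hh1 x)
    simp only [w]
    rw [abs_le]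
    constructor <;> linarith

end Integral

/-! ### Amenability from actions with an invariant mean -/

section Amenable

variable {G : Type*} [Group G]

/-- Integrating an equivariant family of means on `G` against an invariant mean. -/
theorem isAmenableGroup_of_equivariant_means {X : Type*} [MulAction G X] {m : Set X → ℝ}
    (hm : IsMean m) (hinv : ∀ (g : G) (A : Set X), m ((fun x => g • x) '' A) = m A)
    (ν : X → Set G → ℝ) (hν : ∀ x, IsMean (ν x))
    (hequiv : ∀ (g : G) (x : X) (B : Set G), ν (g • x) ((fun y => g * y) '' B) = ν x B) :
    IsAmenableGroup G := by
  obtain ⟨U, μ, hU, hμ⟩ := exists_ultrafilter_tendsto (atTop : Filter ℕ)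
    (fun N (B : Set G) => floorIntegral m (N + 1) fun x => ν x B)
    (fun _ _ => floorIntegral_nonneg hm _ _) (fun _ _ => floorIntegral_le_one hm _ _)
  refine ⟨μ, ⟨fun A => ge_of_tendsto' (hμ A) fun _ => floorIntegral_nonneg hm _ _, ?_, ?_⟩, ?_⟩
  · refine tendsto_nhds_unique (hμ _) ?_
    simp only [(hν _).univ]
    simp only [floorIntegral_one hm (Nat.succ_ne_zero _), tendsto_const_nhds]
  · intro A B hAB
    -- Additivity fails by at most 2 / (N + 1), which vanishes in the limit.
    have h1 := (hμ (A ∪ B)).sub ((hμ A).add (hμ B))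
    have h2 : Tendsto (fun N : ℕ => 2 / (((N + 1 : ℕ) : ℝ))) U (𝓝 0) :=
      (((tendsto_const_div_atTop_nhds_zero_nat 2).comp (tendsto_add_atTop_nat 1))).mono_left hU
    have h3 := squeeze_zero_norm (fun N => (Real.norm_eq_abs _).trans_le <| abs_floorIntegral_add_sub_le hm (N + 1)
      (fun x => (hν x).nonneg A) (fun x => (hν x).nonneg B) (fun x => (hν x).le_one (A ∪ B))
      (fun x => (hν x).union A B hAB)) h2
    linarith [tendsto_nhds_unique h1 h3]
  · intro g A
    -- Invariance is exact for every N: the level sets for gA are the g-translates of those for A.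
    refine tendsto_nhds_unique (hμ _) ((hμ A).congr fun N => ?_)
    refine Finset.sum_congr rfl fun k _ => ?_
    rw [← hinv g]
    congr 2
    ext x
    have h := hequiv g (g⁻¹ • x) A
    rw [smul_inv_smul] at h
    simp only [Set.mem_image, Set.mem_ofPred_eq, floorLevel, h]
    constructor
    · rintro ⟨y, hy, rfl⟩
      simpa using hy
    · intro hx
      exact ⟨g⁻¹ • x, hx, smul_inv_smul _ _⟩

/-- With `r x` the chosen point of the orbit of `x` and `c x` sending `r x` to `x`, the mean of the
stabilizer of `r x` is pushed to the coset of `c x`. Stabilizer invariance makes the result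
independent of the choice of `c x`, hence equivariant in `x`. -/
theorem isAmenableGroup_of_action {X : Type*} [MulAction G X] {m : Set X → ℝ}
    (hm : IsMean m) (hinv : ∀ (g : G) (A : Set X), m ((fun x => g • x) '' A) = m A)
    (hstab : ∀ x : X, IsAmenableGroup (MulAction.stabilizer G x)) : IsAmenableGroup G := by
  choose ν hν hνinv using hstab
  let r : X → X := fun x => Quotient.out (s := MulAction.orbitRel G X) (Quotient.mk _ x)
  have hr : ∀ x, ∃ c : G, c • r x = x := fun x =>
    (MulAction.orbitRel G X).symm (Quotient.mk_out (s := MulAction.orbitRel G X) x)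
  have hrg : ∀ (g : G) x, r (g • x) = r x := fun g x =>
    congrArg Quotient.out (Quotient.sound (s := MulAction.orbitRel G X) ⟨g, rfl⟩)
  choose c hc using hr
  let lam : X → G → Set G → ℝ := fun y d B => ν y {h | d * h ∈ B}
  have hlam : ∀ (y : X) (d d' : G) (B : Set G), d • y = d' • y → lam y d B = lam y d' B := by
    intro y d d' B hd
    have hk : d⁻¹ * d' ∈ MulAction.stabilizer G y := by
      rw [MulAction.mem_stabilizer_iff, mul_smul, ← hd, inv_smul_smul]
    simp only [lam]
    rw [← hνinv y ⟨_, hk⟩ {h | d' * h ∈ B}]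
    congr 1
    ext h
    simp only [Set.mem_image, Set.mem_ofPred_eq]
    constructor
    · intro hh
      exact ⟨⟨_, hk⟩⁻¹ * h, by simpa [mul_assoc] using hh, by simp⟩
    · rintro ⟨k, hk', rfl⟩
      simpa [mul_assoc] using hk'
  refine isAmenableGroup_of_equivariant_means hm hinv (fun x => lam (r x) (c x))
    (fun x => (hν (r x)).map fun h => c x * h) fun g x B => ?_
  have h1 : lam (r (g • x)) (c (g • x)) ((fun y => g * y) '' B) =
      lam (r (g • x)) (g⁻¹ * c (g • x)) B := by
    simp only [lam]
    congr 1
    ext h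
    simp only [Set.mem_image, Set.mem_ofPred_eq]
    constructor
    · rintro ⟨y, hy, hh⟩
      rw [mul_assoc, ← hh]
      simpa using hy
    · intro hh
      exact ⟨_, hh, by simp [mul_assoc]⟩
  show lam (r (g • x)) (c (g • x)) ((fun y => g * y) '' B) = lam (r x) (c x) B
  rw [h1, hrg]
  refine hlam _ _ _ _ ?_
  have h2 := hc (g • x)
  rw [hrg] at h2
  rw [mul_smul, h2, hc, inv_smul_smul]

theorem IsAmenableGroup.of_mulEquiv {H : Type*} [Group H] (hG : IsAmenableGroup G) (e : G ≃* H) :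
    IsAmenableGroup H := by
  obtain ⟨μ, hμ, hinv⟩ := hG
  refine ⟨_, hμ.map e, fun g A => ?_⟩
  rw [← hinv (e.symm g) (e ⁻¹' A)]
  congr 1
  ext x
  simp only [Set.mem_preimage, Set.mem_image]
  constructor
  · rintro ⟨y, hy, h⟩
    exact ⟨e.symm y, by simpa using hy, by rw [← map_mul, h, e.symm_apply_apply]⟩
  · rintro ⟨y, hy, rfl⟩
    exact ⟨e y, hy, by simp⟩

/-- In an action of a non-amenable group with an invariant mean, the stabilizer of almost every
point is non-amenable. -/
theorem mean_amenable_stabilizer_eq_zero {X : Type*} [MulAction G X] {m : Set X → ℝ}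
    (hm : IsMean m) (hinv : ∀ (g : G) (A : Set X), m ((fun x => g • x) '' A) = m A)
    (hG : ¬ IsAmenableGroup G) :
    m {x | IsAmenableGroup (MulAction.stabilizer G x)} = 0 := by
  by_contra h0
  -- Stabilizers along an orbit are conjugate, so this set is invariant; if it is not null, the
  -- normalized restriction of `m` is an invariant mean on it.
  let A : SubMulAction G X :=
    { carrier := {x | IsAmenableGroup (MulAction.stabilizer G x)}
      smul_mem' := fun g x hx => IsAmenableGroup.of_mulEquiv hx
        (MulAction.stabilizerEquivStabilizer (g := g) (a := x) (b := g • x) rfl) }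
  refine hG (isAmenableGroup_of_action (X := A) (hm.subtype h0) (fun g B => ?_) fun x => ?_)
  · have himage : (Subtype.val '' ((fun x : A => g • x) '' B) : Set X) =
        (fun x => g • x) '' (Subtype.val '' B) := by
      rw [Set.image_image, Set.image_image]
      rfl
    exact congrArg (· / _) ((congrArg m himage).trans (hinv g _))
  · have h := x.2
    rw [SubMulAction.stabilizer_of_subMul]
    exact h

theorem isAmenableGroup_of_subsingleton [Subsingleton G] : IsAmenableGroup G := by
  classical
  refine ⟨fun A => if 1 ∈ A then 1 else 0, ⟨fun A => by split_ifs <;> simp, by simp, ?_⟩, ?_⟩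
  · intro A B h
    by_cases hA : (1 : G) ∈ A
    · simp [hA, Set.disjoint_left.1 h hA]
    · simp [hA]
  · intro g A
    have : (fun x => g * x) '' A = A := by
      rw [Subsingleton.elim g 1]
      simp
    rw [this]

theorem isAmenableGroup_of_finset
    (h : ∀ F : Finset G, ∃ μ : Set G → ℝ, IsMean μ ∧
      ∀ g ∈ F, ∀ A : Set G, μ ((fun x => g * x) '' A) = μ A) : IsAmenableGroup G := by
  choose ν hν hinv using h
  obtain ⟨U, μ, hU, hμ⟩ := exists_ultrafilter_tendsto (atTop : Filter (Finset G)) ν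
    (fun F => (hν F).nonneg) (fun F => (hν F).le_one)
  refine ⟨μ, ⟨fun A => ge_of_tendsto' (hμ A) fun F => (hν F).nonneg A, ?_, ?_⟩, ?_⟩
  · refine tendsto_nhds_unique (hμ _) ?_
    simp only [(hν _).univ, tendsto_const_nhds]
  · intro A B hAB
    refine tendsto_nhds_unique (hμ _) (((hμ A).add (hμ B)).congr fun F => ?_)
    exact ((hν F).union A B hAB).symm
  · intro g A
    refine tendsto_nhds_unique (hμ _) ((hμ A).congr' ?_)
    filter_upwards [hU (mem_atTop ({g} : Finset G))] with F hF
    exact (hinv F g (hF (by simp)) A).symm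

/-- A non-amenable subgroup contains a finitely generated non-amenable one, through any given
element. -/
theorem Subgroup.exists_fg_not_amenable {H : Subgroup G} (hH : ¬ IsAmenableGroup H) {x : G}
    (hx : x ∈ H) : ∃ K ≤ H, K.FG ∧ x ∈ K ∧ ¬ IsAmenableGroup K := by
  classical
  by_contra! hcon
  refine hH (isAmenableGroup_of_finset fun F => ?_)
  let T : Finset G := insert x (F.image Subtype.val)
  have hTH : Subgroup.closure (T : Set G) ≤ H := by
    rw [Subgroup.closure_le]
    intro y hy
    simp only [T, Finset.coe_insert, Finset.coe_image, Set.mem_insert_iff, Set.mem_image] at hy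
    rcases hy with rfl | ⟨z, -, rfl⟩
    · exact hx
    · exact z.2
  obtain ⟨μ, hμ, hinv⟩ := hcon _ hTH ⟨T, rfl⟩ (Subgroup.subset_closure (by simp [T]))
  -- A mean on the subgroup generated by `T`, pushed forward to `H`, is invariant under `F`.
  refine ⟨_, hμ.map (Subgroup.inclusion hTH), fun g hg A => ?_⟩
  have hgT : (g : G) ∈ Subgroup.closure (T : Set G) :=
    Subgroup.subset_closure (by simp [T, hg])
  rw [← hinv ⟨g, hgT⟩ (Subgroup.inclusion hTH ⁻¹' A)]
  congr 1
  ext y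
  simp only [Set.mem_preimage, Set.mem_image]
  constructor
  · rintro ⟨z, hz, h⟩
    have h' : z = Subgroup.inclusion hTH (⟨g, hgT⟩⁻¹ * y) := by
      rw [map_mul, ← h, map_inv]
      exact (inv_mul_cancel_left g z).symm
    exact ⟨⟨g, hgT⟩⁻¹ * y, h' ▸ hz, by simp⟩
  · rintro ⟨z, hz, rfl⟩
    exact ⟨_, hz, rfl⟩

end Amenable

/-! ### Conjugation and the q-normal chain -/

section InnerAmenable

variable {G : Type*} [Group G]

/-- Almost every element commutes with a non-amenable subgroup of a given non-amenable
subgroup. -/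
theorem mean_amenable_centralizer_eq_zero {m : Set G → ℝ} (hm : IsMean m)
    (hinv : ∀ (g : G) (A : Set G), m ((fun x => g * x * g⁻¹) '' A) = m A)
    {K : Subgroup G} (hK : ¬ IsAmenableGroup K) :
    m {y | IsAmenableGroup ((Subgroup.centralizer {y}).subgroupOf K)} = 0 := by
  let act : MulAction K G := MulAction.compHom G (MulAut.conj.comp K.subtype)
  have h := @mean_amenable_stabilizer_eq_zero K _ G act m hm (fun g A => hinv g A) hK
  have hstab : ∀ y : G, (Subgroup.centralizer {y}).subgroupOf K = MulAction.stabilizer K y := by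
    intro y
    ext k
    change (k : G) ∈ Subgroup.centralizer {y} ↔ (k : G) * y * (k : G)⁻¹ = y
    rw [Subgroup.mem_centralizer_singleton_iff, mul_inv_eq_iff_eq_mul]
  have hset : {y | IsAmenableGroup ((Subgroup.centralizer {y}).subgroupOf K)} =
      {y | IsAmenableGroup (MulAction.stabilizer K y)} := by
    ext y
    exact iff_of_eq (congrArg (fun H : Subgroup K => IsAmenableGroup H) (hstab y))
  rw [hset]
  exact h

theorem infinite_of_ne_one_of_zpowers_le (htf : IsTorsionFreeGroup G) {x : G} (hx : x ≠ 1)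
    {A : Set G} (hA : ∀ n : ℤ, x ^ n ∈ A) : A.Infinite := by
  have : ¬ IsOfFinOrder x := fun h => hx (htf x h)
  exact Set.infinite_of_injective_forall_mem (injective_zpow_iff_not_isOfFinOrder.2 this) hA

/-- A non-amenable group is nontrivial, so some k ≠ 1 in `K` commutes with `y`; its powers all lie
in the intersection. -/
theorem infinite_conj_inter_of_not_amenable (htf : IsTorsionFreeGroup G) {K : Subgroup G} {y : G}
    (h : ¬ IsAmenableGroup ((Subgroup.centralizer {y}).subgroupOf K)) :
    (((fun x => y * x * y⁻¹) '' (K : Set G)) ∩ (K : Set G)).Infinite := by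
  have hnt : Nontrivial ((Subgroup.centralizer {y}).subgroupOf K) := by
    by_contra hn
    rw [not_nontrivial_iff_subsingleton] at hn
    exact h isAmenableGroup_of_subsingleton
  obtain ⟨⟨k, hk⟩, hk1⟩ := exists_ne (1 : (Subgroup.centralizer {y}).subgroupOf K)
  have hk' : (k : G) * y = y * k := Subgroup.mem_centralizer_singleton_iff.1 hk
  refine infinite_of_ne_one_of_zpowers_le htf (x := k) (by simpa using hk1) fun n => ?_
  have hc : (k : G) ^ n * y = y * (k : G) ^ n := ((show Commute (k : G) y from hk').zpow_left n)
  refine ⟨⟨_, K.zpow_mem k.2 n, ?_⟩, K.zpow_mem k.2 n⟩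
  simp [← hc]

/-- A torsion-free, finitely generated, inner-amenable, non-amenable group contains a q-normal
finitely generated subgroup reached from an infinite cyclic group in two q-normal steps. -/
theorem exists_qNormal_chain (hfg : Group.FG G) (htf : IsTorsionFreeGroup G)
    (hin : IsInnerAmenableGroup G) (hna : ¬ IsAmenableGroup G) :
    ∃ (K L : Subgroup G) (x : K), x ≠ 1 ∧ K.FG ∧ L.FG ∧ K ≤ L ∧
      IsQNormal (Subgroup.zpowers x) ∧ IsQNormal (K.subgroupOf L) ∧ IsQNormal L := by
  classical
  obtain ⟨m, hm, hinv, hatom⟩ := hin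
  have htop : ¬ IsAmenableGroup (⊤ : Subgroup G) := fun h =>
    hna (h.of_mulEquiv Subgroup.topEquiv)
  have hexists : ∀ A : Set G, m A = 0 → ∃ x, x ∉ A := by
    intro A hA
    by_contra! hall
    rw [Set.eq_univ_of_forall hall, hm.univ] at hA
    exact one_ne_zero hA
  obtain ⟨x, hx⟩ := hexists _
    (hm.union_null (mean_amenable_centralizer_eq_zero hm hinv htop) (hatom 1))
  simp only [Set.mem_union, Set.mem_ofPred_eq, Set.mem_singleton_iff, not_or] at hx
  obtain ⟨hxa, hx1⟩ := hx
  have hcx : ¬ IsAmenableGroup (Subgroup.centralizer {x}) := fun h =>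
    hxa (h.of_mulEquiv (Subgroup.subgroupOfEquivOfLe le_top).symm)
  obtain ⟨K, hKx, hKfg, hxK, hK⟩ := Subgroup.exists_fg_not_amenable hcx
    (Subgroup.mem_centralizer_singleton_iff.2 rfl)
  obtain ⟨S, hS⟩ := hfg.out
  let N : Set G := {y | IsAmenableGroup ((Subgroup.centralizer {y}).subgroupOf K)}
  have hN : m N = 0 := mean_amenable_centralizer_eq_zero hm hinv hK
  -- Each conjugate sNs⁻¹ is null, so `y` can avoid them all; s = 1 is included to control `y`
  -- itself.
  obtain ⟨y, hy⟩ := hexists _ (hm.union_null (hm.biUnion_finset_null (insert 1 S)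
    (fun s => (fun x => s * x * s⁻¹) '' N) fun s _ => (hinv s N).trans hN) (hatom 1))
  simp only [Set.mem_union, Set.mem_iUnion, Set.mem_singleton_iff, not_or, not_exists] at hy
  obtain ⟨hyN, hy1⟩ := hy
  have hconj : ∀ s ∈ insert 1 S, s⁻¹ * y * s ∉ N := fun s hs h =>
    hyN s hs ⟨_, h, by simp [mul_assoc]⟩
  let Y : Finset G := (insert 1 S).image fun s => s⁻¹ * y * s
  let L : Subgroup G := K ⊔ Subgroup.closure (Y : Set G)
  have hKL : K ≤ L := le_sup_left
  have hYL : ∀ s ∈ insert 1 S, s⁻¹ * y * s ∈ L := fun s hs =>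
    le_sup_right (a := K) (Subgroup.subset_closure (Finset.mem_coe.2 (Finset.mem_image_of_mem _ hs)))
  have hyL : y ∈ L := by simpa using hYL 1 (by simp)
  refine ⟨K, L, ⟨x, hxK⟩, fun h => hx1 (congrArg Subtype.val h), hKfg, hKfg.sup ⟨Y, rfl⟩, hKL,
    ⟨Set.univ, Subgroup.closure_univ, fun k _ => ?_⟩,
    ⟨{g | (g : G) ∈ (K : Set G) ∪ Y}, ?_, fun g hg => ?_⟩, ⟨S, hS, fun s hs => ?_⟩⟩
  · refine Set.Infinite.of_image Subtype.val
      (infinite_of_ne_one_of_zpowers_le htf hx1 fun n => ?_)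
    have hk : (k : G) * x = x * k := Subgroup.mem_centralizer_singleton_iff.1 (hKx k.2)
    have hc : (k : G) * x ^ n = x ^ n * k := (show Commute (k : G) x from hk).zpow_right n
    have hz : (⟨x, hxK⟩ : K) ^ n ∈ Subgroup.zpowers (⟨x, hxK⟩ : K) := ⟨n, rfl⟩
    exact ⟨⟨x, hxK⟩ ^ n, ⟨⟨_, hz, Subtype.ext (by simp [hc])⟩, hz⟩, by simp⟩
  · refine Subgroup.map_injective L.subtype_injective ?_
    rw [MonoidHom.map_closure, ← MonoidHom.range_eq_map, Subgroup.range_subtype]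
    have : L.subtype '' {g : L | (g : G) ∈ (K : Set G) ∪ Y} = (K : Set G) ∪ Y := by
      ext g
      refine ⟨?_, fun hg => ⟨⟨g, ?_⟩, hg, rfl⟩⟩
      · rintro ⟨h, hh, rfl⟩
        exact hh
      · rcases hg with hg | hg
        · exact hKL hg
        · exact le_sup_right (a := K) (Subgroup.subset_closure hg)
    rw [this, Subgroup.closure_union, Subgroup.closure_eq]
  -- For g in `K` the intersection contains ⟨x⟩, which g centralizes; for g in `Y` genericity
  -- applies.
  · refine Set.Infinite.of_image Subtype.val (s := _) ?_
    have hinf : (((fun x => (g : G) * x * (g : G)⁻¹) '' (K : Set G)) ∩ (K : Set G)).Infinite := by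
      rcases hg with hg | hg
      · refine infinite_of_ne_one_of_zpowers_le htf hx1 fun n => ?_
        have hk : (g : G) * x = x * g := Subgroup.mem_centralizer_singleton_iff.1 (hKx hg)
        have hc : (g : G) * x ^ n = x ^ n * g := (show Commute (g : G) x from hk).zpow_right n
        exact ⟨⟨_, K.zpow_mem hxK n, by simp [hc]⟩, K.zpow_mem hxK n⟩
      · obtain ⟨s, hs, hsg⟩ := Finset.mem_image.1 (Finset.mem_coe.1 hg)
        exact infinite_conj_inter_of_not_amenable htf (hsg ▸ hconj s hs)
    refine hinf.mono ?_
    rintro _ ⟨⟨k, hk, rfl⟩, hk'⟩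
    exact ⟨⟨_, hKL hk'⟩, ⟨⟨⟨k, hKL hk⟩, hk, rfl⟩, hk'⟩, rfl⟩
  -- Both y and s⁻¹ys lie in `L`, so ⟨y⟩ is contained in L ∩ sLs⁻¹.
  · refine infinite_of_ne_one_of_zpowers_le htf hy1 fun n => ⟨⟨_, L.zpow_mem
      (hYL s (Finset.mem_insert_of_mem hs)) n, ?_⟩, L.zpow_mem hyL n⟩
    have h := conj_zpow (i := n) (a := s⁻¹) (b := y)
    rw [inv_inv] at h
    simp only [h]
    group

end InnerAmenable

/-! ### Carrying `P` from the integers up the chain -/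

theorem theorem3p5
    (C P : ∀ (G : Type u) [Group G], Prop)
    -- `C` is a class of finitely generated, torsion-free groups
    (hC_fg : ∀ (G : Type u) [Group G], C G → Group.FG G)
    (hC_tf : ∀ (G : Type u) [Group G], C G → IsTorsionFreeGroup G)
    -- `C` contains the integers (copied into the universe at hand)
    (hC_int : C (ULift.{u} (Multiplicative ℤ)))
    -- `C` is closed under taking finitely generated subgroups
    (hC_sub : ∀ (G : Type u) [Group G] (H : Subgroup G), C G → H.FG → C H)
    -- on the class `C`, the property `P` is invariant under isomorphism
    (hP_iso : ∀ (G H : Type u) [Group G] [Group H], C G → C H → Nonempty (G ≃* H) → P G → P H)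
    -- the integers satisfy `P`
    (hP_int : P (ULift.{u} (Multiplicative ℤ)))
    -- `P` passes from `L` to `G` whenever `L` is q-normal in `G`, both in `C`
    (hP_q : ∀ (G : Type u) [Group G] (L : Subgroup G), C G → C L → IsQNormal L → P L → P G)
    (G : Type u) [Group G] (hG : C G) (hG_inner : IsInnerAmenableGroup G)
    (hG_non : ¬ IsAmenableGroup G) :
    P G := by
  have htf := hC_tf G hG
  obtain ⟨K, L, x, hx, hK, hL, hKL, hq1, hq2, hq3⟩ :=
    exists_qNormal_chain (hC_fg G hG) htf hG_inner hG_non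
  have hCK := hC_sub G K hG hK
  have hCL := hC_sub G L hG hL
  have hCx : C (Subgroup.zpowers x) :=
    hC_sub K _ hCK ⟨{x}, by rw [Finset.coe_singleton, Subgroup.zpowers_eq_closure]⟩
  have hPx : P (Subgroup.zpowers x) := by
    refine hP_iso _ _ hC_int hCx ⟨MulEquiv.ulift.trans ?_⟩ hP_int
    have hinf : Infinite (Subgroup.zpowers x) :=
      (infinite_zpowers.2 fun h => hx (hC_tf K hCK x h)).to_subtype
    exact intCyclicMulEquiv
  have hCK' : C (K.subgroupOf L) := by
    refine hC_sub L _ hCL ?_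
    rw [← Group.fg_iff_subgroup_fg] at hK ⊢
    exact Group.fg_of_surjective (f := (Subgroup.subgroupOfEquivOfLe hKL).symm.toMonoidHom)
      (Subgroup.subgroupOfEquivOfLe hKL).symm.surjective
  have hPK := hP_iso _ _ hCK hCK' ⟨(Subgroup.subgroupOfEquivOfLe hKL).symm⟩
    (hP_q K _ hCK hCx hq1 hPx)
  exact hP_q G L hG hCL hq3 (hP_q L _ hCL hCK' hq2 hPK)
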